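/- Let $G$ be a group. For $k\ge 1$, an elementary Nielsen transformation of $G^k$ replaces, for some index $i$, the component $g_i$ of a $k$-tuple $(g_1,\dots,g_k)$ by $g_jg_i$ for some $j\neq i$, or by $g_i^{-1}$, and leaves the other components unchanged. The elementary AC-transformations of $G^k$ are the elementary Nielsen transformations together with the transformations that replace one component $g_i$ by a conjugate $x^{-1}g_ix$ with $x\in G$ and leave the other components unchanged. Two $k$-tuples are Nielsen equivalent (resp. AC-equivalent) if one is obtained from the other by a finite sequence of elementary Nielsen (resp. AC-) transformations. An $n$-tuple of elements of $G$ is a normally generating $n$-vector if the smallest normal subgroup of $G$ containing its components is $G$, and the weight $w(G)$ is the least $n$ for which $G$ has a normally generating $n$-vector. Let $\pi_{ab}\colon G\to G_{ab}=G/[G,G]$ be the abelianization homomorphism, applied to tuples componentwise. **Theorem.** Every finitely generated soluble group $G$ satisfies the generalized Andrews–Curtis conjecture in the sense of Borovik, Lubotzky and Myasnikov: for every integer $n\ge\max(w(G),2)$ and any two normally generating $n$-vectors $\mathbf g,\mathbf h$ of $G$, the vectors $\mathbf g$ and $\mathbf h$ are AC-equivalent in $G^n$ if and only if $\pi_{ab}(\mathbf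 g)$ and $\pi_{ab}(\mathbf h)$ are AC-equivalent in $G_{ab}^n$. Moreover, the latter holds if and only if $\pi_{ab}(\mathbf g)$ and $\pi_{ab}(\mathbf h)$ are Nielsen equivalent. -/

import Mathlib

namespace AndrewsCurtis

/-- The elementary Nielsen transformations of `G^k`: for some index `i`, the component `g i` is
replaced by `g j * g i` for some `j ≠ i`, or by `(g i)⁻¹`; the other components are unchanged.
`NielsenStep g h` says that some elementary Nielsen transformation sends `g` to `h`. -/
inductive NielsenStep {G : Type*} [Group G] {k : ℕ} : (Fin k → G) → (Fin k → G) → Prop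
  | mul (g : Fin k → G) (i j : Fin k) (hij : j ≠ i) :
      NielsenStep g (Function.update g i (g j * g i))
  | inv (g : Fin k → G) (i : Fin k) :
      NielsenStep g (Function.update g i (g i)⁻¹)

/-- The elementary Andrews–Curtis transformations of `G^k`: the elementary Nielsen transformations
together with the replacement of one component `g i` by a conjugate `x⁻¹ * g i * x`, `x ∈ G`. -/
inductive ACStep {G : Type*} [Group G] {k : ℕ} : (Fin k → G) → (Fin k → G) → Prop
  | nielsen (g h : Fin k → G) (hgh : NielsenStep g h) : ACStep g h
  | conj (g : Fin k → G) (i : Fin k) (x : G) :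
      ACStep g (Function.update g i (x⁻¹ * g i * x))

/-- `h` is obtained from `g` by a Nielsen transformation, that is, by the composition of a finite
number of elementary Nielsen transformations. -/
def NielsenEquivalent {G : Type*} [Group G] {k : ℕ} (g h : Fin k → G) : Prop :=
  Relation.ReflTransGen NielsenStep g h

/-- `h` is obtained from `g` by an AC-transformation, that is, by the composition of a finite
number of elementary AC-transformations. -/
def ACEquivalent {G : Type*} [Group G] {k : ℕ} (g h : Fin k → G) : Prop :=
  Relation.ReflTransGen ACStep g h

/-- The components of the `n`-vector `g` normally generate `G`. -/
def NormallyGenerates {G : Type*} [Group G] {n : ℕ} (g : Fin n → G) : Prop :=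
  Subgroup.normalClosure (Set.range g) = ⊤

/-- The weight `w(G)`: the minimal number of elements which normally generate `G`.
(The set is nonempty whenever `G` is finitely generated.) -/
noncomputable def weight (G : Type*) [Group G] : ℕ :=
  sInf {n : ℕ | ∃ g : Fin n → G, NormallyGenerates g}

/-- The componentwise image of a vector under the abelianization homomorphism. -/
def abVec {G : Type*} [Group G] {n : ℕ} (g : Fin n → G) : Fin n → Abelianization G :=
  fun i => Abelianization.of (g i)

/-- The condition defining the generalized Andrews–Curtis conjecture for `G` in the sense of
Borovik, Lubotzky and Myasnikov. -/
def SatisfiesGAC (G : Type*) [Group G] : Prop :=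
  ∀ n : ℕ, max (weight G) 2 ≤ n → ∀ g h : Fin n → G,
    NormallyGenerates g → NormallyGenerates h →
      (ACEquivalent g h ↔ ACEquivalent (abVec g) (abVec h))

end AndrewsCurtis

/-! AC-equivalences lift along surjections, so it suffices that `commutator G` is absorbed:
multiplying a component by an element of it never changes the AC-class of a normally generating
vector (`Absorbs`). Absorption passes up through quotients (`Absorbs.of_map_mk`), so one climbs the
derived series from the trivial group. Three facts, applied modulo what is already absorbed, carry
the climb: `[C, G]` is absorbed if `C` is abelian and normal (`absorbs_commutator_of_comm`); `[[H,
G], [H, G]]` is absorbed if `H` is normal and `[H, H]` is central (`absorbs_commutator_commutator`);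
`[G, G]` is absorbed if it is central. Suppose `[H, H]'` is absorbed, with `H` a term of the derived
series below `G`. The first fact absorbs `[[H, H], G]`, the second `[[H, G], [H, G]]`, and the first
again `[[H, G], G]`. By the three subgroups lemma this contains `[[G, G], H]`, hence `[H, H]`. For
`H = G` the third fact finishes. -/

namespace AndrewsCurtis

open Function Subgroup commutatorElement

/-! ### AC-moves, their lifting along surjections, and normal generation -/

section Moves

variable {G : Type*} [Group G] {n : ℕ}

theorem ACEquivalent.refl (g : Fin n → G) : ACEquivalent g g := Relation.ReflTransGen.refl

theorem ACEquivalent.trans {g h k : Fin n → G} (hgh : ACEquivalent g h)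
    (hhk : ACEquivalent h k) : ACEquivalent g k := Relation.ReflTransGen.trans hgh hhk

theorem acEquivalent_update_mul (g : Fin n → G) {i j : Fin n} (hij : j ≠ i) (y : G) :
    ACEquivalent (update g i y) (update g i (g j * y)) := by
  have h := ACStep.nielsen _ _ (NielsenStep.mul (update g i y) i j hij)
  simp only [update_idem, update_self, update_of_ne hij] at h
  exact .single h

theorem acEquivalent_update_inv (g : Fin n → G) (i : Fin n) (y : G) :
    ACEquivalent (update g i y) (update g i y⁻¹) := by
  have h := ACStep.nielsen _ _ (NielsenStep.inv (update g i y) i)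
  simp only [update_idem, update_self] at h
  exact .single h

theorem acEquivalent_update_conj (g : Fin n → G) (i : Fin n) (x y : G) :
    ACEquivalent (update g i y) (update g i (x * y * x⁻¹)) := by
  have h := ACStep.conj (update g i y) i x⁻¹
  simp only [update_idem, update_self, inv_inv] at h
  exact .single h

/-- Left multiplication of the `i`-th component by an element of the normal closure of the other
components is an AC-transformation. -/
theorem acEquivalent_update_of_mem_normalClosure (g : Fin n → G) (i : Fin n) {w : G}
    (hw : w ∈ normalClosure (g '' {i}ᶜ)) (y : G) :
    ACEquivalent (update g i y) (update g i (w * y)) := by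
  -- The admissible factors form a normal subgroup; for inverses, pass through `y⁻¹`, `w * y⁻¹`, `y
  -- * w⁻¹`, then conjugate by `y⁻¹`.
  let S : Subgroup G :=
    { carrier := {w | ∀ y, ACEquivalent (update g i y) (update g i (w * y))}
      one_mem' := fun y => by simpa using ACEquivalent.refl _
      mul_mem' := fun {v w} hv hw y => by
        simpa [mul_assoc] using (hw y).trans (hv (w * y))
      inv_mem' := fun {w} hw y => by
        have h := ((acEquivalent_update_inv g i y).trans (hw y⁻¹)).trans
          ((acEquivalent_update_inv g i _).trans (acEquivalent_update_conj g i y⁻¹ _))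
        simpa [mul_assoc] using h }
  have hS : ∀ w ∈ S, ∀ x, x * w * x⁻¹ ∈ S := fun w hw x y => by
    have h := ((acEquivalent_update_conj g i x⁻¹ y).trans (hw _)).trans
      (acEquivalent_update_conj g i x _)
    simpa [mul_assoc] using h
  have : S.Normal := ⟨hS⟩
  have hle : normalClosure (g '' {i}ᶜ) ≤ S := by
    refine normalClosure_le_normal ?_
    rintro _ ⟨j, hj, rfl⟩ y
    exact acEquivalent_update_mul g hj y
  exact hle hw y

theorem ACStep.map {H : Type*} [Group H] (f : G →* H) {g h : Fin n → G} (hgh : ACStep g h) :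
    ACStep (f ∘ g) (f ∘ h) := by
  cases hgh with
  | nielsen _ h =>
    cases h with
    | mul i j hij =>
      rw [comp_update, map_mul]; exact .nielsen _ _ (.mul (f ∘ g) i j hij)
    | inv i =>
      rw [comp_update, map_inv]; exact .nielsen _ _ (.inv (f ∘ g) i)
  | conj i x =>
    rw [comp_update, map_mul, map_mul, map_inv]; exact .conj (f ∘ g) i (f x)

theorem ACEquivalent.map {H : Type*} [Group H] (f : G →* H) {g h : Fin n → G}
    (hgh : ACEquivalent g h) : ACEquivalent (f ∘ g) (f ∘ h) :=
  Relation.ReflTransGen.lift (fun g : Fin n → G => f ∘ g) (fun _ _ => ACStep.map f) _ _ hgh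

theorem ACStep.exists_lift {H : Type*} [Group H] {f : G →* H} (hf : Surjective f)
    (g : Fin n → G) {h : Fin n → H} (hgh : ACStep (f ∘ g) h) :
    ∃ h' : Fin n → G, ACStep g h' ∧ f ∘ h' = h := by
  cases hgh with
  | nielsen _ h =>
    cases h with
    | mul i j hij =>
      exact ⟨_, .nielsen _ _ (.mul g i j hij), by rw [comp_update, map_mul]; rfl⟩
    | inv i =>
      exact ⟨_, .nielsen _ _ (.inv g i), by rw [comp_update, map_inv]; rfl⟩
  | conj i x =>
    obtain ⟨x, rfl⟩ := hf x
    exact ⟨_, .conj g i x, by rw [comp_update, map_mul, map_mul, map_inv]; rfl⟩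

theorem ACEquivalent.exists_lift {H : Type*} [Group H] {f : G →* H} (hf : Surjective f)
    (g : Fin n → G) {h : Fin n → H} (hgh : ACEquivalent (f ∘ g) h) :
    ∃ h' : Fin n → G, ACEquivalent g h' ∧ f ∘ h' = h := by
  induction hgh with
  | refl => exact ⟨g, .refl g, rfl⟩
  | tail _ hstep ih =>
    obtain ⟨k, hk, rfl⟩ := ih
    obtain ⟨h', hh', rfl⟩ := ACStep.exists_lift hf k hstep
    exact ⟨h', hk.tail hh', rfl⟩

theorem NormallyGenerates.update {g : Fin n → G} (hg : NormallyGenerates g) (i : Fin n) {y : G}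
    (hy : ∀ N : Subgroup G, N.Normal → y ∈ N → (∀ j ≠ i, g j ∈ N) → g i ∈ N) :
    NormallyGenerates (Function.update g i y) := by
  rw [NormallyGenerates, eq_top_iff, ← hg]
  have hmem : ∀ k, Function.update g i y k ∈ normalClosure (Set.range (Function.update g i y)) :=
    fun k => subset_normalClosure ⟨k, rfl⟩
  have hne : ∀ j ≠ i, g j ∈ normalClosure (Set.range (Function.update g i y)) := fun j hj => by
    simpa [update_of_ne hj] using hmem j
  refine normalClosure_le_normal ?_
  rintro _ ⟨k, rfl⟩
  by_cases hk : k = i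
  · subst hk
    exact hy _ inferInstance (by simpa using hmem k) hne
  · exact hne k hk

theorem NormallyGenerates.of_acStep {g h : Fin n → G} (hg : NormallyGenerates g)
    (hgh : ACStep g h) : NormallyGenerates h := by
  cases hgh with
  | nielsen _ h =>
    cases h with
    | mul i j hij =>
      exact hg.update i fun N _ hy hN => (N.mul_mem_cancel_left (hN j hij)).1 hy
    | inv i => exact hg.update i fun N _ hy _ => N.inv_mem_iff.1 hy
  | conj i x =>
    refine hg.update i fun N hN hy _ => ?_
    simpa [mul_assoc] using hN.conj_mem _ hy x

theorem NormallyGenerates.of_acEquivalent {g h : Fin n → G} (hg : NormallyGenerates g)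
    (hgh : ACEquivalent g h) : NormallyGenerates h := by
  induction hgh with
  | refl => exact hg
  | tail _ hstep ih => exact ih.of_acStep hstep

theorem NormallyGenerates.map {H : Type*} [Group H] {f : G →* H} (hf : Surjective f)
    {g : Fin n → G} (hg : NormallyGenerates g) : NormallyGenerates (f ∘ g) := by
  rw [NormallyGenerates, Set.range_comp, ← Subgroup.map_normalClosure _ f hf, hg,
    ← MonoidHom.range_eq_map, MonoidHom.range_eq_top.2 hf]

theorem nielsenEquivalent_of_acEquivalent {A : Type*} [CommGroup A] {g h : Fin n → A}
    (hgh : ACEquivalent g h) : NielsenEquivalent g h := by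
  induction hgh with
  | refl => exact .refl
  | tail _ hstep ih =>
    cases hstep with
    | nielsen _ h => exact ih.tail h
    | conj i x => simpa using ih

theorem NielsenEquivalent.acEquivalent {g h : Fin n → G} (hgh : NielsenEquivalent g h) :
    ACEquivalent g h := Relation.ReflTransGen.mono ACStep.nielsen _ _ hgh

end Moves

/-! ### Absorbed subgroups -/

section Good

variable {G : Type*} [Group G]

/-- Multiplying a component of a normally generating `n`-vector by an element of `N` does not
change its AC-class. -/
def Absorbs (n : ℕ) (N : Subgroup G) : Prop :=
  ∀ g : Fin n → G, NormallyGenerates g → ∀ i, ∀ k ∈ N, ACEquivalent g (update g i (k * g i))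

theorem Absorbs.mono {n : ℕ} {M N : Subgroup G} (hN : Absorbs n N) (h : M ≤ N) : Absorbs n M :=
  fun g hg i k hk => hN g hg i k (h hk)

theorem absorbs_bot (n : ℕ) : Absorbs n (⊥ : Subgroup G) := by
  intro g _ i k hk
  rw [mem_bot.1 hk, one_mul, update_eq_self]
  exact .refl g

theorem Absorbs.acEquivalent {n : ℕ} {N : Subgroup G} (hN : Absorbs n N) {g h : Fin n → G}
    (hg : NormallyGenerates g) (hgh : ∀ i, h i * (g i)⁻¹ ∈ N) : ACEquivalent g h := by
  have key : ∀ s : Finset (Fin n), ACEquivalent g (s.piecewise h g) := by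
    intro s
    induction s using Finset.induction_on with
    | empty => simpa using ACEquivalent.refl g
    | insert i s hi ih =>
      have h1 := hN _ (hg.of_acEquivalent ih) i _ (hgh i)
      rw [Finset.piecewise_eq_of_notMem _ _ _ hi, inv_mul_cancel_right] at h1
      rw [Finset.piecewise_insert]
      exact ih.trans h1
  simpa using key Finset.univ

/-- The AC-sequence found in `G ⧸ N` lifts to `G`; its endpoint misses the target only by factors in
`N`. -/
theorem Absorbs.of_map_mk {n : ℕ} {M N : Subgroup G} [N.Normal] (hN : Absorbs n N)
    (hM : Absorbs n (M.map (QuotientGroup.mk' N))) : Absorbs n M := by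
  intro g hg i k hk
  have hs := QuotientGroup.mk'_surjective N
  have h1 := hM _ (hg.map hs) i _ (mem_map_of_mem _ hk)
  obtain ⟨h, hgh, hh⟩ := ACEquivalent.exists_lift hs g h1
  refine hgh.trans (hN.acEquivalent (hg.of_acEquivalent hgh) fun j => ?_)
  rw [← QuotientGroup.ker_mk' N, ← div_eq_mul_inv, MonoidHom.mem_ker, map_div, div_eq_one]
  have h2 := congrFun hh j
  simp only [comp_apply] at h2
  rw [h2]
  by_cases hj : j = i
  · subst hj; simp
  · simp [update_of_ne hj]

end Good

/-! ### Reversibility of AC-moves -/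

section Symm

variable {G : Type*} [Group G] {n : ℕ}

theorem ACStep.symm {g h : Fin n → G} (hgh : ACStep g h) : ACEquivalent h g := by
  cases hgh with
  | nielsen _ h =>
    cases h with
    | mul i j hij =>
      have h := acEquivalent_update_of_mem_normalClosure g i
        (inv_mem (subset_normalClosure ⟨j, hij, rfl⟩)) (g j * g i)
      simpa using h
    | inv i => simpa using acEquivalent_update_inv g i (g i)⁻¹
  | conj i x =>
    simpa [mul_assoc] using acEquivalent_update_conj g i x (x⁻¹ * g i * x)

theorem ACEquivalent.symm {g h : Fin n → G} (hgh : ACEquivalent g h) : ACEquivalent h g := by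
  induction hgh with
  | refl => exact .refl g
  | tail _ hstep ih => exact hstep.symm.trans ih

end Symm

/-! ### Moves on two components, the others being fixed -/

section Pairs

variable {G : Type*} [Group G] {n : ℕ}

/-- The vector `g` with its components `i` and `j` replaced by `x` and `y`. -/
def withPair (g : Fin n → G) (i j : Fin n) (x y : G) : Fin n → G := update (update g i x) j y

/-- The normal closure of `x` and of the components of `g` other than `i` and `j`. -/
def pairClosure (g : Fin n → G) (i j : Fin n) (x : G) : Subgroup G :=
  normalClosure (insert x (g '' {i, j}ᶜ))

instance (g : Fin n → G) (i j : Fin n) (x : G) : (pairClosure g i j x).Normal :=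
  normalClosure_normal

variable {g : Fin n → G} {i j : Fin n}

omit [Group G] in
theorem withPair_self (g : Fin n → G) (i j : Fin n) : withPair g i j (g i) (g j) = g := by
  simp [withPair]

omit [Group G] in
theorem withPair_update_left (g : Fin n → G) (hij : i ≠ j) (x : G) :
    withPair g i j x (g j) = update g i x := by
  rw [withPair, update_comm hij, update_eq_self]

theorem self_mem_pairClosure (x : G) : x ∈ pairClosure g i j x :=
  subset_normalClosure (Set.mem_insert _ _)

theorem pairClosure_le {x : G} {N : Subgroup G} [N.Normal] (hx : x ∈ N)
    (hN : ∀ k, k ≠ i → k ≠ j → g k ∈ N) : pairClosure g i j x ≤ N := by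
  refine normalClosure_le_normal (Set.insert_subset hx ?_)
  rintro _ ⟨k, hk, rfl⟩
  simp only [Set.mem_compl_iff, Set.mem_insert_iff, Set.mem_singleton_iff, not_or] at hk
  exact hN k hk.1 hk.2

theorem apply_mem_pairClosure {k : Fin n} (hi : k ≠ i) (hj : k ≠ j) (x : G) :
    g k ∈ pairClosure g i j x :=
  subset_normalClosure (Set.mem_insert_of_mem _ ⟨k, by simp [hi, hj], rfl⟩)

theorem pairClosure_le_sup {x y : G} {N : Subgroup G} [N.Normal] (h : y * x⁻¹ ∈ N) :
    pairClosure g i j x ≤ pairClosure g i j y ⊔ N := by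
  refine pairClosure_le ?_ fun k hi hj => mem_sup_left (apply_mem_pairClosure hi hj y)
  have := mul_mem (inv_mem (mem_sup_right (S := pairClosure g i j y) h))
    (mem_sup_left (T := N) (self_mem_pairClosure (g := g) (i := i) (j := j) y))
  simpa using this

theorem pairClosure_sup_pairClosure (hij : i ≠ j) (hg : NormallyGenerates g) :
    pairClosure g i j (g j) ⊔ pairClosure g i j (g i) = ⊤ := by
  rw [eq_top_iff, ← hg]
  refine normalClosure_le_normal ?_
  rintro _ ⟨k, rfl⟩
  by_cases hi : k = i
  · subst hi; exact mem_sup_right (self_mem_pairClosure _)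
  by_cases hj : k = j
  · subst hj; exact mem_sup_left (self_mem_pairClosure _)
  · exact mem_sup_left (apply_mem_pairClosure hi hj _)

theorem acEquivalent_withPair_left (hij : i ≠ j) {w y : G} (hw : w ∈ pairClosure g i j y)
    (x : G) : ACEquivalent (withPair g i j x y) (withPair g i j (w * x) y) := by
  rw [withPair, withPair, update_comm hij, update_comm hij]
  refine acEquivalent_update_of_mem_normalClosure _ i (pairClosure_le ?_ ?_ hw) x
  · exact subset_normalClosure ⟨j, hij.symm, by simp⟩
  · exact fun k hi hj => subset_normalClosure ⟨k, hi, by simp [hj]⟩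

theorem acEquivalent_withPair_right (hij : i ≠ j) {w x : G} (hw : w ∈ pairClosure g i j x)
    (y : G) : ACEquivalent (withPair g i j x y) (withPair g i j x (w * y)) := by
  refine acEquivalent_update_of_mem_normalClosure _ j (pairClosure_le ?_ ?_ hw) y
  · exact subset_normalClosure ⟨i, hij, by simp⟩
  · exact fun k hi hj => subset_normalClosure ⟨k, hj, by simp [hi]⟩

theorem acEquivalent_withPair_conj (hij : i ≠ j) (x y z : G) :
    ACEquivalent (withPair g i j x y) (withPair g i j (z * x * z⁻¹) y) := by
  rw [withPair, withPair, update_comm hij, update_comm hij]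
  exact acEquivalent_update_conj _ i z x

/-- The elements of `C` by which the `i`-th component of every vector that agrees with `g` outside
`i` and is congruent to `g` modulo `C` can be multiplied without changing the AC-class. -/
def shifts (g : Fin n → G) (i j : Fin n) (C : Subgroup G) : Subgroup G where
  -- Quantifying over the whole coset of `g i`, not just `g i`, makes this closed under products.
  carrier := {z | z ∈ C ∧ ∀ x, x * (g i)⁻¹ ∈ C →
    ACEquivalent (withPair g i j x (g j)) (withPair g i j (z * x) (g j))}
  one_mem' := ⟨one_mem C, fun x _ => by simpa using ACEquivalent.refl _⟩
  mul_mem' := fun {z w} hz hw => ⟨mul_mem hz.1 hw.1, fun x hx => by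
    have h := (hw.2 x hx).trans (hz.2 (w * x) (by simpa [mul_assoc] using mul_mem hw.1 hx))
    simpa [mul_assoc] using h⟩
  inv_mem' := fun {z} hz => ⟨inv_mem hz.1, fun x hx => by
    have h := hz.2 (z⁻¹ * x) (by simpa [mul_assoc] using mul_mem (inv_mem hz.1) hx)
    simpa using h.symm⟩

theorem mem_shifts_of_mem_pairClosure {C : Subgroup G} (hij : i ≠ j) {z : G} (hz : z ∈ C)
    (h : z ∈ pairClosure g i j (g j)) : z ∈ shifts g i j C :=
  ⟨hz, fun x _ => acEquivalent_withPair_left hij h x⟩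

theorem absorbs_of_le_shifts (hn : 2 ≤ n) {M C : Subgroup G}
    (h : ∀ g : Fin n → G, NormallyGenerates g → ∀ i j, i ≠ j → M ≤ shifts g i j C) :
    Absorbs n M := by
  intro g hg i k hk
  have : Nontrivial (Fin n) := Fin.nontrivial_iff_two_le.2 hn
  obtain ⟨j, hj⟩ := exists_ne i
  have h1 := (h g hg i j hj.symm hk).2 (g i) (by simp)
  rwa [withPair_self, withPair_update_left g hj.symm] at h1

end Pairs

/-! ### Abelian normal subgroups -/

section AbelianNormal

variable {G : Type*} [Group G] {n : ℕ}

theorem commutator_sup_self_le {K C : Subgroup G} [K.Normal] (hC : ⁅C, C⁆ = ⊥) :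
    ⁅K ⊔ C, K ⊔ C⁆ ≤ K := by
  rw [commutator_le]
  intro x hx y hy
  obtain ⟨k, hk, c, hc, rfl⟩ := mem_sup_of_normal_left.1 hx
  obtain ⟨l, hl, d, hd, rfl⟩ := mem_sup_of_normal_left.1 hy
  have h1 : (⁅c, d⁆ : G) = 1 := by simpa [hC] using commutator_mem_commutator hc hd
  rw [← QuotientGroup.ker_mk' K] at hk hl ⊢
  rw [MonoidHom.mem_ker] at hk hl ⊢
  rw [map_commutatorElement, map_mul, map_mul, hk, hl, one_mul, one_mul, ← map_commutatorElement,
    h1, map_one]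

theorem commutator_top_le_shifts {C : Subgroup G} [C.Normal] (hC : ⁅C, C⁆ = ⊥)
    {g : Fin n → G} (hg : NormallyGenerates g) {i j : Fin n} (hij : i ≠ j) :
    ⁅(⊤ : Subgroup G), C⁆ ≤ shifts g i j C := by
  have hcomm : ∀ c ∈ C, ∀ d ∈ C, c * d = d * c := fun c hc d hd => by
    rw [← commutatorElement_eq_one_iff_mul_comm]
    simpa [hC] using commutator_mem_commutator hc hd
  have hconj : ∀ c ∈ C, ∀ x : G, x * c * x⁻¹ ∈ C := fun c hc x => Normal.conj_mem ‹_› c hc x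
  have hcC : ∀ x : G, ∀ c ∈ C, ⁅x, c⁆ ∈ C := fun x c hc => mul_mem (hconj c hc x) (inv_mem hc)
  let W : Subgroup G :=
    { carrier := {x | ∀ c ∈ C, ⁅x, c⁆ ∈ shifts g i j C}
      one_mem' := fun c _ => by simp
      mul_mem' := fun {x y} hx hy c hc => by
        have h : (⁅x * y, c⁆ : G) = ⁅x, y * c * y⁻¹⁆ * ⁅y, c⁆ := by
          simp only [commutatorElement_def]; group
        rw [h]
        exact mul_mem (hx _ (hconj c hc y)) (hy c hc)
      inv_mem' := fun {x} hx c hc => by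
        have h : (⁅x⁻¹, c⁆ : G) = ⁅x, x⁻¹ * c * x⁻¹⁻¹⁆⁻¹ := by
          simp only [commutatorElement_def]; group
        rw [h]
        exact inv_mem (hx _ (hconj c hc x⁻¹)) }
  -- `W` is shown to be all of `G`: it contains the closure of the components other than `i`, then
  -- `g i`, then `[G, G]`, which makes it normal.
  have hb : pairClosure g i j (g j) ≤ W := fun x hx c hc =>
    mem_shifts_of_mem_pairClosure hij (hcC x c hc)
      (commutator_le_left _ ⊤ (commutator_mem_commutator hx (mem_top c)))
  -- As `C` is abelian, conjugation by `c` multiplies every `x` in the coset of `g i` by the same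
  -- factor `⁅g i, c⁆⁻¹`.
  have ha : g i ∈ W := fun c hc => by
    refine inv_mem_iff.1 ⟨inv_mem (hcC _ c hc), fun x hx => ?_⟩
    have h := acEquivalent_withPair_conj (g := g) hij x (g j) c
    have h2 : c * x * c⁻¹ = (⁅g i, c⁆ : G)⁻¹ * x := by
      have h3 := hcomm _ hx _ (hconj _ (inv_mem hc) (g i))
      calc c * x * c⁻¹ = c * ((x * (g i)⁻¹) * (g i * c⁻¹ * (g i)⁻¹)) * g i := by group
        _ = _ := by rw [h3, commutatorElement_def]; group
    rwa [h2] at h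
  -- Since `C` is abelian, `u` lies in the closure of every `x` in the coset. So `g j` can become `u
  -- * g j`, supply the factor `⁅u * g j, c⁆`, and be restored.
  have hu : ⁅pairClosure g i j (g i), pairClosure g i j (g i)⁆ ≤ W := by
    intro u hu c hc
    have hmem : ∀ x, x * (g i)⁻¹ ∈ C → u ∈ pairClosure g i j x := fun x hx => by
      have hle := pairClosure_le_sup (g := g) (i := i) (j := j) hx
      exact commutator_sup_self_le hC (commutator_mono hle hle hu)
    have key : ∀ c ∈ C, ⁅u * g j, c⁆ ∈ shifts g i j C := fun c hc => by
      refine ⟨hcC _ c hc, fun x hx => ?_⟩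
      have h1 := acEquivalent_withPair_right hij (hmem x hx) (g j)
      have h2 := acEquivalent_withPair_left (g := g) hij (w := ⁅u * g j, c⁆) (y := u * g j)
        (commutator_le_left _ ⊤
          (commutator_mem_commutator (self_mem_pairClosure _) (mem_top c))) x
      have h3 := acEquivalent_withPair_right hij
        (inv_mem (hmem (⁅u * g j, c⁆ * x) (by
          simpa [mul_assoc] using mul_mem (hcC (u * g j) c hc) hx))) (u * g j)
      rw [inv_mul_cancel_left] at h3
      exact (h1.trans h2).trans h3
    have hc' := hconj c hc (g j)⁻¹
    have h : (⁅u, c⁆ : G) = ⁅u * g j, (g j)⁻¹ * c * (g j)⁻¹⁻¹⁆ * ⁅g j, (g j)⁻¹ * c * (g j)⁻¹⁻¹⁆⁻¹ := by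
      simp only [commutatorElement_def]; group
    rw [h]
    exact mul_mem (key _ hc') (inv_mem (hb (self_mem_pairClosure _) _ hc'))
  have hW : ⁅(⊤ : Subgroup G), ⊤⁆ ≤ W := by
    rw [← pairClosure_sup_pairClosure hij hg]
    set A := pairClosure g i j (g j)
    set B := pairClosure g i j (g i)
    refine le_trans ?_ (sup_le hb hu)
    have hle : A ⊔ B ≤ (A ⊔ ⁅B, B⁆) ⊔ B := sup_le_sup_right le_sup_left _
    rw [commutator_le]
    intro x hx y hy
    obtain ⟨a, haA, b, hbB, rfl⟩ := mem_sup_of_normal_left.1 hx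
    obtain ⟨a', haA', b', hbB', rfl⟩ := mem_sup_of_normal_left.1 hy
    have h1 : a ∈ A ⊔ ⁅B, B⁆ := mem_sup_left haA
    have h2 : a' ∈ A ⊔ ⁅B, B⁆ := mem_sup_left haA'
    have h3 : ⁅b, b'⁆ ∈ A ⊔ ⁅B, B⁆ := mem_sup_right (commutator_mem_commutator hbB hbB')
    rw [← QuotientGroup.ker_mk' (A ⊔ ⁅B, B⁆), MonoidHom.mem_ker] at h1 h2 h3 ⊢
    rw [map_commutatorElement, map_mul, map_mul, h1, h2, one_mul, one_mul,
      ← map_commutatorElement, h3]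
  have hWn : W.Normal := commutator_top_left_le_iff.1 ((commutator_mono le_rfl le_top).trans hW)
  have htop : W = ⊤ := by
    rw [eq_top_iff, ← pairClosure_sup_pairClosure hij hg]
    exact sup_le hb (pairClosure_le ha fun k hi hj => hb (apply_mem_pairClosure hi hj _))
  rw [commutator_le]
  exact fun x _ c hc => (htop ▸ mem_top x : x ∈ W) c hc

theorem absorbs_commutator_of_comm (hn : 2 ≤ n) {C : Subgroup G} [C.Normal] (hC : ⁅C, C⁆ = ⊥) :
    Absorbs n ⁅C, (⊤ : Subgroup G)⁆ := by
  rw [commutator_comm]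
  exact absorbs_of_le_shifts hn fun g hg i j hij => commutator_top_le_shifts hC hg hij

end AbelianNormal

/-! ### Subgroups with central commutator subgroup -/

section ClassTwo

variable {G : Type*} [Group G] {n : ℕ}

theorem commutator_sup_le_sup (H K L : Subgroup G) [H.Normal] [K.Normal] [L.Normal] :
    ⁅H, K ⊔ L⁆ ≤ ⁅H, K⁆ ⊔ ⁅H, L⁆ := by
  rw [commutator_le]
  intro h hh x hx
  obtain ⟨k, hk, l, hl, rfl⟩ := mem_sup_of_normal_left.1 hx
  have h1 : (⁅h, k * l⁆ : G) = ⁅h, k⁆ * (k * ⁅h, l⁆ * k⁻¹) := by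
    simp only [commutatorElement_def]; group
  rw [h1]
  exact mul_mem (mem_sup_left (commutator_mem_commutator hh hk)) (mem_sup_right
    (Normal.conj_mem inferInstance _ (commutator_mem_commutator hh hl) k))

theorem commutator_sup_le_of_le_center (H K Z : Subgroup G) [H.Normal] [K.Normal] [Z.Normal]
    (hZ : Z ≤ center G) : ⁅H, K ⊔ Z⁆ ≤ ⁅H, K⁆ := by
  refine (commutator_sup_le_sup H K Z).trans (sup_le le_rfl ?_)
  have : ⁅H, Z⁆ ≤ ⊥ := (commutator_mono le_rfl hZ).trans (commutator_center_right H).le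
  exact this.trans bot_le

/-- With `b = g j`, change `b` to `b * u`, so that `⁅b * u, x⁆ = ⁅u, x⁆ * ⁅b, x⁆` can multiply `a`;
then remove the unwanted `⁅b, x⁆` and restore `b`. -/
theorem commutator_mem_shifts {H : Subgroup G} [H.Normal] (hH : ⁅H, H⁆ ≤ center G)
    {g : Fin n → G} {i j : Fin n} (hij : i ≠ j) {u x : G}
    (hu : u ∈ ⁅H, pairClosure g i j (g i)⁆) (hxH : x ∈ H) (hx : x ∈ pairClosure g i j (g i)) :
    ⁅u, x⁆ ∈ shifts g i j ⁅H, H⁆ := by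
  have huH : u ∈ H := commutator_le_left _ _ hu
  refine ⟨commutator_mem_commutator huH hxH, fun a ha => ?_⟩
  have hAH : ⁅H, H⁆ ≤ H := commutator_le_left _ _
  have hle := pairClosure_le_sup (g := g) (i := i) (j := j) ha
  set N := pairClosure g i j a with hN
  -- Changing `x` by the central element `α` does not affect `⁅u, x⁆`, so `x` may be taken in `N`.
  obtain ⟨x, hxN, α, hα, rfl⟩ := mem_sup_of_normal_left.1 (hle hx)
  have hxH : x ∈ H := (H.mul_mem_cancel_right (hAH hα)).1 hxH
  have hux : (⁅u, x * α⁆ : G) = ⁅u, x⁆ := by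
    have h1 := mem_center_iff.1 (hH hα)
    calc (⁅u, x * α⁆ : G) = u * x * (α * u⁻¹ * α⁻¹) * x⁻¹ := by
          rw [commutatorElement_def]; group
      _ = ⁅u, x⁆ := by rw [← h1, mul_inv_cancel_right, commutatorElement_def]
  rw [hux]
  replace hu : u ∈ ⁅H, N⁆ :=
    commutator_sup_le_of_le_center H N ⁅H, H⁆ hH (commutator_mono le_rfl hle hu)
  have huN : u ∈ N := commutator_le_right _ _ hu
  set b := g j with hb
  set z : G := ⁅u, x⁆ with hz
  set s : G := ⁅b, x⁆ with hs
  have hzA : z ∈ ⁅H, H⁆ := commutator_mem_commutator huH hxH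
  have hzc := mem_center_iff.1 (hH hzA)
  have hzN : z ∈ N := commutator_le_left N ⊤ (commutator_mem_commutator huN (mem_top x))
  have hsH : s ∈ H := commutator_le_right ⊤ H (commutator_mem_commutator (mem_top b) hxH)
  have hsN : s ∈ N := commutator_le_right ⊤ N (commutator_mem_commutator (mem_top b) hxN)
  have step1 : ACEquivalent (withPair g i j a b) (withPair g i j a (b * u)) := by
    have h := acEquivalent_withPair_right (g := g) hij
      (Normal.conj_mem (hN ▸ inferInstance : N.Normal) u huN b) b
    simpa using h
  have step2 : ACEquivalent (withPair g i j a (b * u)) (withPair g i j (z * s * a) (b * u)) := by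
    refine acEquivalent_withPair_left hij ?_ a
    have h1 : z * s = ⁅b * u, x⁆ := by
      calc z * s = b * z * b⁻¹ * s := by rw [hzc b, mul_inv_cancel_right]
        _ = _ := by simp only [hz, hs, commutatorElement_def]; group
    rw [h1]
    exact commutator_le_left _ ⊤
      (commutator_mem_commutator (self_mem_pairClosure _) (mem_top x))
  have hle2 : N ≤ pairClosure g i j (z * s * a) ⊔ (H ⊓ N) := by
    refine pairClosure_le_sup ?_
    rw [mul_inv_cancel_right]
    exact ⟨mul_mem (hAH hzA) hsH, mul_mem hzN hsN⟩
  -- The new first entry yields `u` only up to a central `c`, which is harmless: `⁅b * c, x⁆ = ⁅b,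
  -- x⁆`.
  obtain ⟨v, hv, c, hc, hvc⟩ := mem_sup_of_normal_left.1
    (commutator_sup_le_sup H _ _ (commutator_mono le_rfl hle2 hu))
  have hcc := mem_center_iff.1 (hH (commutator_mono le_rfl inf_le_left hc))
  have step3 : ACEquivalent (withPair g i j (z * s * a) (b * u))
      (withPair g i j (z * s * a) (b * c)) := by
    have h := acEquivalent_withPair_right (g := g) hij (x := z * s * a)
      (Normal.conj_mem inferInstance _ (inv_mem (commutator_le_right _ _ hv)) b) (b * u)
    rwa [show b * v⁻¹ * b⁻¹ * (b * u) = b * c by rw [← hvc]; group] at h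
  have step4 : ACEquivalent (withPair g i j (z * s * a) (b * c))
      (withPair g i j (z * a) (b * c)) := by
    have h1 : (⁅b * c, x⁆ : G) = s := by
      calc (⁅b * c, x⁆ : G) = b * (c * x * c⁻¹) * b⁻¹ * x⁻¹ := by
            rw [commutatorElement_def]; group
        _ = s := by rw [← hcc, mul_inv_cancel_right, hs, commutatorElement_def]
    have h2 : s ∈ pairClosure g i j (b * c) := by
      rw [← h1]
      exact commutator_le_left _ ⊤
        (commutator_mem_commutator (self_mem_pairClosure _) (mem_top x))
    have h := acEquivalent_withPair_left (g := g) hij (inv_mem h2) (z * s * a)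
    rw [← hzc s] at h ⊢
    rw [mul_assoc s] at h ⊢
    rwa [inv_mul_cancel_left] at h
  have hcz : c ∈ pairClosure g i j (z * a) := by
    have h1 : z * a * a⁻¹ ∈ ⁅H, H⁆ := by rwa [mul_inv_cancel_right]
    have h2 : N ≤ pairClosure g i j (z * a) ⊔ ⁅H, H⁆ := pairClosure_le_sup h1
    exact commutator_le_right _ _ (commutator_sup_le_of_le_center H _ ⁅H, H⁆ hH
      (commutator_mono le_rfl (inf_le_right.trans h2) hc))
  have step5 : ACEquivalent (withPair g i j (z * a) (b * c)) (withPair g i j (z * a) b) := by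
    have h := acEquivalent_withPair_right (g := g) hij (inv_mem hcz) (b * c)
    rw [hcc] at h ⊢
    rwa [inv_mul_cancel_left] at h
  exact (((step1.trans step2).trans step3).trans step4).trans step5

theorem absorbs_commutator_commutator (hn : 2 ≤ n) {H : Subgroup G} [H.Normal]
    (hH : ⁅H, H⁆ ≤ center G) :
    Absorbs n ⁅⁅H, (⊤ : Subgroup G)⁆, ⁅H, (⊤ : Subgroup G)⁆⁆ := by
  refine absorbs_of_le_shifts (C := ⁅H, H⁆) hn fun g hg i j hij => ?_
  have hle : ⁅H, (⊤ : Subgroup G)⁆ ≤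
      ⁅H, pairClosure g i j (g j)⁆ ⊔ ⁅H, pairClosure g i j (g i)⁆ := by
    rw [← pairClosure_sup_pairClosure hij hg]
    exact commutator_sup_le_sup H _ _
  have hcen : ∀ h ∈ H, ∀ k ∈ H, ∀ y : G, y * ⁅h, k⁆ * y⁻¹ = ⁅h, k⁆ := fun h hh k hk y => by
    rw [mem_center_iff.1 (hH (commutator_mem_commutator hh hk)), mul_inv_cancel_right]
  have hleft : ∀ e ∈ ⁅H, pairClosure g i j (g j)⁆, ∀ h ∈ H, ⁅e, h⁆ ∈ shifts g i j ⁅H, H⁆ :=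
    fun e he h hh => mem_shifts_of_mem_pairClosure hij
      (commutator_mem_commutator (commutator_le_left _ _ he) hh)
      (commutator_le_left _ ⊤ (commutator_mem_commutator (commutator_le_right _ _ he) (mem_top h)))
  rw [commutator_le]
  intro p hp q hq
  have hqH : q ∈ H := commutator_le_left _ _ hq
  obtain ⟨e, he, f, hf, rfl⟩ := mem_sup_of_normal_left.1 (hle hp)
  obtain ⟨e', he', f', hf', rfl⟩ := mem_sup_of_normal_left.1 (hle hq)
  have hfH : f ∈ H := commutator_le_left _ _ hf
  have hfH' : f' ∈ H := commutator_le_left _ _ hf'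
  -- The outer factors lie in the closure of the components other than `i`; only `⁅f, f'⁆` needs
  -- `commutator_mem_shifts`.
  have h1 : (⁅e * f, e' * f'⁆ : G) = ⁅e', f⁆⁻¹ * ⁅f, f'⁆ * ⁅e, e' * f'⁆ := by
    rw [commutatorElement_inv, ← hcen f hfH f' hfH' e']
    calc (⁅e * f, e' * f'⁆ : G) = e * ⁅f, e' * f'⁆ * e⁻¹ * ⁅e, e' * f'⁆ := by
          simp only [commutatorElement_def]; group
      _ = ⁅f, e' * f'⁆ * ⁅e, e' * f'⁆ := by rw [hcen f hfH _ hqH]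
      _ = _ := by simp only [commutatorElement_def]; group
  rw [h1]
  exact mul_mem (mul_mem (inv_mem (hleft e' he' f hfH))
    (commutator_mem_shifts hH hij hf hfH' (commutator_le_right _ _ hf'))) (hleft e he _ hqH)

theorem absorbs_commutator_of_le_center (hc : ⁅(⊤ : Subgroup G), (⊤ : Subgroup G)⁆ ≤ center G) :
    Absorbs n ⁅(⊤ : Subgroup G), (⊤ : Subgroup G)⁆ := by
  intro g hg i k hk
  -- Modulo the other components, `g i` alone normally generates a group of class at most two, and
  -- such a group is abelian.
  suffices h : ⁅(⊤ : Subgroup G), (⊤ : Subgroup G)⁆ ≤ normalClosure (g '' {i}ᶜ) by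
    simpa using acEquivalent_update_of_mem_normalClosure g i (h hk) (g i)
  set K := normalClosure (g '' {i}ᶜ)
  let f := QuotientGroup.mk' K
  have hf : Surjective f := QuotientGroup.mk'_surjective K
  have hQ : ⁅(⊤ : Subgroup (G ⧸ K)), ⊤⁆ ≤ center (G ⧸ K) := by
    rw [commutator_le]
    intro x _ y _
    obtain ⟨x, rfl⟩ := hf x
    obtain ⟨y, rfl⟩ := hf y
    rw [← map_commutatorElement, mem_center_iff]
    intro w
    obtain ⟨w, rfl⟩ := hf w
    rw [← map_mul, ← map_mul,
      mem_center_iff.1 (hc (commutator_mem_commutator (mem_top x) (mem_top y)))]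
  have hne : ∀ j, j ≠ i → f (g j) = 1 := fun j hj => by
    rw [← MonoidHom.mem_ker, QuotientGroup.ker_mk']
    exact subset_normalClosure ⟨j, hj, rfl⟩
  have htop : ∀ N : Subgroup (G ⧸ K), ⁅(⊤ : Subgroup (G ⧸ K)), ⊤⁆ ≤ N → f (g i) ∈ N → N = ⊤ := by
    intro N hN hi
    have hNn : N.Normal := commutator_top_left_le_iff.1 ((commutator_mono le_rfl le_top).trans hN)
    rw [eq_top_iff, ← hg.map hf]
    refine normalClosure_le_normal ?_
    rintro _ ⟨j, rfl⟩
    by_cases hj : j = i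
    · rw [hj]; exact hi
    · simp only [comp_apply, hne j hj]; exact one_mem N
  have hcent := htop (centralizer {f (g i)})
    (hQ.trans (center_le_centralizer _)) (mem_centralizer_singleton_iff.2 rfl)
  have hcen : center (G ⧸ K) = ⊤ := htop _ hQ <| mem_center_iff.2 fun w => by
    have hw : w ∈ centralizer {f (g i)} := hcent ▸ mem_top w
    exact mem_centralizer_singleton_iff.1 hw
  rw [commutator_le]
  intro x _ y _
  rw [← QuotientGroup.ker_mk' K, MonoidHom.mem_ker, map_commutatorElement,
    commutatorElement_eq_one_iff_mul_comm]
  exact mem_center_iff.1 (hcen ▸ mem_top (f y)) (f x)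

end ClassTwo

/-! ### Climbing the derived series -/

section Solvable

variable {G : Type*} [Group G] {n : ℕ}

theorem map_mk_eq_bot_iff {N : Subgroup G} [N.Normal] {M : Subgroup G} :
    M.map (QuotientGroup.mk' N) = ⊥ ↔ M ≤ N := by
  rw [Subgroup.map_eq_bot_iff, QuotientGroup.ker_mk']

theorem map_mk_top (N : Subgroup G) [N.Normal] :
    (⊤ : Subgroup G).map (QuotientGroup.mk' N) = ⊤ :=
  map_top_of_surjective _ (QuotientGroup.mk'_surjective N)

theorem map_mk_le_center {N M : Subgroup G} [N.Normal] (h : ⁅M, (⊤ : Subgroup G)⁆ ≤ N) :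
    M.map (QuotientGroup.mk' N) ≤ center (G ⧸ N) := by
  rw [← commutator_top_right_eq_bot_iff_le_center, ← map_mk_top N, ← map_commutator,
    map_mk_eq_bot_iff]
  exact h

theorem Absorbs.commutator_of_comm (hn : 2 ≤ n) {N C : Subgroup G} [N.Normal] [C.Normal]
    (hN : Absorbs n N) (hC : ⁅C, C⁆ ≤ N) : Absorbs n ⁅C, (⊤ : Subgroup G)⁆ := by
  refine hN.of_map_mk ?_
  have : (C.map (QuotientGroup.mk' N)).Normal :=
    Normal.map ‹_› _ (QuotientGroup.mk'_surjective N)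
  rw [map_commutator, map_mk_top]
  refine absorbs_commutator_of_comm hn ?_
  rw [← map_commutator, map_mk_eq_bot_iff]
  exact hC

theorem Absorbs.commutator_commutator (hn : 2 ≤ n) {N H : Subgroup G} [N.Normal] [H.Normal]
    (hN : Absorbs n N) (hH : ⁅⁅H, H⁆, (⊤ : Subgroup G)⁆ ≤ N) :
    Absorbs n ⁅⁅H, (⊤ : Subgroup G)⁆, ⁅H, (⊤ : Subgroup G)⁆⁆ := by
  refine hN.of_map_mk ?_
  have : (H.map (QuotientGroup.mk' N)).Normal :=
    Normal.map ‹_› _ (QuotientGroup.mk'_surjective N)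
  rw [map_commutator, map_commutator, map_mk_top]
  refine absorbs_commutator_commutator hn ?_
  rw [← map_commutator]
  exact map_mk_le_center hH

theorem Absorbs.commutator_of_le_center {N : Subgroup G} [N.Normal]
    (hN : Absorbs n N) (h : ⁅⁅(⊤ : Subgroup G), (⊤ : Subgroup G)⁆, (⊤ : Subgroup G)⁆ ≤ N) :
    Absorbs n ⁅(⊤ : Subgroup G), (⊤ : Subgroup G)⁆ := by
  refine hN.of_map_mk ?_
  have h1 := map_mk_le_center h
  rw [map_commutator, map_mk_top] at h1 ⊢
  exact absorbs_commutator_of_le_center h1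

theorem commutator_top_commutator_le {H N : Subgroup G} [N.Normal]
    (h : ⁅⁅H, (⊤ : Subgroup G)⁆, (⊤ : Subgroup G)⁆ ≤ N) :
    ⁅⁅(⊤ : Subgroup G), (⊤ : Subgroup G)⁆, H⁆ ≤ N := by
  rw [← map_mk_eq_bot_iff] at h ⊢
  simp only [map_commutator] at h ⊢
  refine commutator_commutator_eq_bot_of_rotate ?_ h
  rwa [commutator_comm ((⊤ : Subgroup G).map _)]

theorem Absorbs.derivedSeries_of_succ (hn : 2 ≤ n) (k : ℕ)
    (h : Absorbs n (derivedSeries G (k + 2))) : Absorbs n (derivedSeries G (k + 1)) := by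
  have hA : Absorbs n ⁅derivedSeries G (k + 1), (⊤ : Subgroup G)⁆ := h.commutator_of_comm hn le_rfl
  cases k with
  | zero => exact hA.commutator_of_le_center le_rfl
  | succ k =>
    set H := derivedSeries G (k + 1) with hH
    have hHG : H ≤ ⁅(⊤ : Subgroup G), (⊤ : Subgroup G)⁆ := commutator_mono le_top le_top
    have h2 : Absorbs n ⁅⁅H, (⊤ : Subgroup G)⁆, ⁅H, (⊤ : Subgroup G)⁆⁆ :=
      hA.commutator_commutator hn le_rfl
    have h3 : Absorbs n ⁅⁅H, (⊤ : Subgroup G)⁆, (⊤ : Subgroup G)⁆ :=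
      h2.commutator_of_comm hn le_rfl
    exact h3.mono ((commutator_mono hHG le_rfl).trans (commutator_top_commutator_le le_rfl))

theorem absorbs_commutator [Group.IsSolvable G] (hn : 2 ≤ n) : Absorbs n (commutator G) := by
  obtain ⟨d, hd⟩ := Group.IsSolvable.solvable (G := G)
  have key : ∀ k, Absorbs n (derivedSeries G (k + 1)) → Absorbs n (derivedSeries G 1) := by
    intro k
    -- The climb stops at the first derived subgroup; `derivedSeries G 0` is `G` itself.
    induction k with
    | zero => exact id
    | succ k ih => exact fun h => ih (h.derivedSeries_of_succ hn k)
  rw [← derivedSeries_one]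
  refine key d ((absorbs_bot n).mono ?_)
  rw [← hd]
  exact derivedSeries_antitone G d.le_succ

theorem acEquivalent_iff_abVec [Group.IsSolvable G] (hn : 2 ≤ n) {g h : Fin n → G}
    (hg : NormallyGenerates g) : ACEquivalent g h ↔ ACEquivalent (abVec g) (abVec h) := by
  refine ⟨ACEquivalent.map Abelianization.of, fun hgh => ?_⟩
  obtain ⟨k, hgk, hk⟩ :=
    ACEquivalent.exists_lift (f := Abelianization.of) QuotientGroup.mk_surjective g hgh
  refine hgk.trans ((absorbs_commutator hn).acEquivalent (hg.of_acEquivalent hgk) fun i => ?_)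
  rw [← Abelianization.ker_of, ← div_eq_mul_inv, MonoidHom.mem_ker, map_div, div_eq_one]
  exact (congrFun hk i).symm

end Solvable

end AndrewsCurtis

theorem mainTheorem1 {G : Type*} [Group G] [Group.FG G] [Group.IsSolvable G] :
    AndrewsCurtis.SatisfiesGAC G ∧
    ∀ n : ℕ, max (AndrewsCurtis.weight G) 2 ≤ n → ∀ g h : Fin n → G,
      AndrewsCurtis.NormallyGenerates g → AndrewsCurtis.NormallyGenerates h →
        (AndrewsCurtis.ACEquivalent (AndrewsCurtis.abVec g) (AndrewsCurtis.abVec h) ↔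
          AndrewsCurtis.NielsenEquivalent (AndrewsCurtis.abVec g) (AndrewsCurtis.abVec h)) :=
  ⟨fun _ hn _ _ hg _ => AndrewsCurtis.acEquivalent_iff_abVec (le_of_max_le_right hn) hg,
    fun _ _ _ _ _ _ => ⟨AndrewsCurtis.nielsenEquivalent_of_acEquivalent,
      AndrewsCurtis.NielsenEquivalent.acEquivalent⟩⟩
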